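/- Let $a_1,a_2,a_3\in\mathbb C\setminus\{0\}$ and let $$A=\begin{bmatrix}0&a_1&0&0\\a_1^{-1}&0&a_2&0\\0&a_2^{-1}&0&a_3\\0&0&a_3^{-1}&0\end{bmatrix}$$ be the corresponding $4\times4$ reciprocal matrix. Put $A_j=\frac{|a_j|^2+|a_j|^{-2}}{2}$ for $j=1,2,3$ (so $A_j=\frac{a_j^2+a_j^{-2}}2$ if $a_j>0$). Call a subset of $\mathbb C$ bi-elliptical if it is the convex hull of two non-degenerate ellipses (circles being allowed) that have distinct centers and neither of which is contained in the closed elliptical disk bounded by the other. Then the numerical range $W(A)=\{\langle Ax,x\rangle : x\in\mathbb C^4,\ \|x\|=1\}$ is bi-elliptical if and only if $$A_1=A_3>1\quad\text{and}\quad A_2=1.$$ Moreover, $A_1=A_3>1$ is equivalent to: $|a_1|=|a_3|\neq1$ or $|a_1|=|a_3|^{-1}\neq1$; and $A_2=1$ is equivalent to $|a_2|=1$. In particular, for $a_1,a_2,a_3>0$, $W(A)$ is bi-elliptical if and only if $a_2=1$ and $a_1=a_3^{\pm1}\neq1$. -/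

import Mathlib

noncomputable section

/-- The numerical range `W(A) = {⟨Ax, x⟩ : x ∈ ℂⁿ, ‖x‖ = 1}`. The inner product of Mathlib is
linear in its second argument; with the inner product linear in the first one `⟨Ax, x⟩` is `inner ℂ x (A x)`. -/
def numericalRange {n : ℕ} (A : Matrix (Fin n) (Fin n) ℂ) : Set ℂ :=
  {z | ∃ x : EuclideanSpace ℂ (Fin n), ‖x‖ = 1 ∧ inner ℂ x (Matrix.toEuclideanLin A x) = z}

/-- The (non-degenerate) ellipse with center `c` and semi-axes of lengths `p` and `q`, the axis
of length `p` having direction `exp (iφ)`. Here `p, q > 0`; circles are ellipses. -/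
def IsEllipse (E : Set ℂ) (c : ℂ) : Prop :=
  ∃ φ p q : ℝ, 0 < p ∧ 0 < q ∧
    E = Set.range fun t : ℝ =>
      c + Complex.exp (φ * Complex.I) * ((p * Real.cos t : ℝ) + (q * Real.sin t : ℝ) * Complex.I)

/-- A set is bi-elliptical if it is the convex hull of two ellipses with distinct centers, neither
of which lies in the closed elliptical disk bounded by the other (otherwise the convex hull is just
an elliptical disk). -/
def IsBiElliptical (S : Set ℂ) : Prop :=
  ∃ (E₁ E₂ : Set ℂ) (c₁ c₂ : ℂ), IsEllipse E₁ c₁ ∧ IsEllipse E₂ c₂ ∧ c₁ ≠ c₂ ∧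
    ¬ E₁ ⊆ convexHull ℝ E₂ ∧ ¬ E₂ ⊆ convexHull ℝ E₁ ∧ S = convexHull ℝ (E₁ ∪ E₂)

/-- The 4-by-4 reciprocal matrix with superdiagonal entries `a₁, a₂, a₃`. -/
def reciprocalMatrix (a₁ a₂ a₃ : ℂ) : Matrix (Fin 4) (Fin 4) ℂ :=
  !![0, a₁, 0, 0;
     a₁⁻¹, 0, a₂, 0;
     0, a₂⁻¹, 0, a₃;
     0, 0, a₃⁻¹, 0]

/-- The quantity `(|a|² + |a|⁻²) / 2`, which is `(a² + a⁻²) / 2` for `a > 0`. -/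
def reciprocalMean (a : ℂ) : ℝ := (‖a‖ ^ 2 + (‖a‖ ^ 2)⁻¹) / 2

end

/-!
The largest component of `W(A)` in the direction `exp (iθ)` is the largest eigenvalue of
`Re (exp (-iθ) A)`, hence the largest root of the quartic `μ⁴ - (s₁ + s₂ + s₃) μ² + s₁ s₃` with
`sⱼ = (Aⱼ + cos 2θ) / 2`.

If `A₁ = A₃` and `A₂ = 1`, then `s₂ = cos² θ` and the quartic splits into
`(μ² - μ cos θ - s₁) (μ² + μ cos θ - s₁)`. The largest roots of the two factors are the support
functions of two ellipses centered at `±1/2`. As `W(A)` is convex (Toeplitz–Hausdorff) and compact,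
it is the convex hull of these ellipses.

Conversely, let `W(A)` be the hull of two ellipses, and let `ℓ + r` be the support function of one
with center `c ≠ 0`, where `ℓ(θ) = Re (exp (-iθ) c)`. It is a root of the quartic on the interval
where this ellipse dominates the other one, hence everywhere, by analyticity. Replacing `θ` by
`θ + π`, so is `-ℓ + r`, and the quartic being even, its roots are `±ℓ ± r`. Therefore
`s₁ + s₂ + s₃ = 2 (ℓ² + r²)` and `s₁ s₃ = (ℓ² - r²)²`. Eliminating `r`, the second identity makes
`(A₁ + cos 2θ) (A₃ + cos 2θ)` the square of a trigonometric polynomial, so `A₁ = A₃`. Where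
`ℓ = 0` it gives `s₁ = s₃ = r²`, so that `s₂ = 0`: since `A₂ ≥ 1`, this means `A₂ = 1` and
`cos 2θ = -1`, and `r > 0` yields `A₁ > 1`.
-/

open scoped ComplexConjugate ComplexStarModule ContDiff Real

section DirectionalPart

/-- The component `Re (exp (-iθ) z)` of a complex number in the direction `exp (iθ)`, as a real
linear functional. -/
noncomputable def directionalPart (θ : ℝ) : ℂ →L[ℝ] ℝ :=
  Real.cos θ • Complex.reCLM + Real.sin θ • Complex.imCLM

lemma directionalPart_apply (θ : ℝ) (z : ℂ) :
    directionalPart θ z = Real.cos θ * z.re + Real.sin θ * z.im := rfl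

lemma directionalPart_eq_re_exp_mul (θ : ℝ) (z : ℂ) :
    directionalPart θ z = (Complex.exp ((-θ : ℝ) * Complex.I) * z).re := by
  simp only [directionalPart_apply, Complex.mul_re, Complex.exp_ofReal_mul_I_re,
    Complex.exp_ofReal_mul_I_im, Real.cos_neg, Real.sin_neg]
  ring

lemma directionalPart_eq_norm_mul_cos (θ : ℝ) (z : ℂ) :
    directionalPart θ z = ‖z‖ * Real.cos (z.arg - θ) := by
  rw [directionalPart_apply, Real.cos_sub]
  linear_combination -Real.cos θ * Complex.norm_mul_cos_arg z
    - Real.sin θ * Complex.norm_mul_sin_arg z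

lemma directionalPart_antiperiodic (z : ℂ) :
    Function.Antiperiodic (fun θ => directionalPart θ z) π := fun θ => by
  simp only [directionalPart_apply, Real.cos_add_pi, Real.sin_add_pi]
  ring

lemma contDiff_directionalPart (z : ℂ) {n : WithTop ℕ∞} :
    ContDiff ℝ n fun θ => directionalPart θ z := by
  simp only [directionalPart_apply]
  fun_prop

lemma isGreatest_range_directionalPart (z : ℂ) :
    IsGreatest (Set.range fun θ => directionalPart θ z) ‖z‖ := by
  simp only [directionalPart_eq_norm_mul_cos]
  refine ⟨⟨z.arg, by simp⟩, ?_⟩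
  rintro _ ⟨θ, rfl⟩
  exact mul_le_of_le_one_right (norm_nonneg z) (Real.cos_le_one _)

lemma exists_eq_smul_directionalPart (f : ℂ →L[ℝ] ℝ) :
    ∃ r : ℝ, 0 ≤ r ∧ ∃ θ, f = r • directionalPart θ := by
  let w : ℂ := ⟨f 1, f Complex.I⟩
  refine ⟨‖w‖, norm_nonneg w, w.arg, ContinuousLinearMap.ext fun z => ?_⟩
  have hz : z = z.re • (1 : ℂ) + z.im • Complex.I := by simp
  calc f z = z.re * f 1 + z.im * f Complex.I := by
        rw [hz, map_add, map_smul, map_smul]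
        simp
    _ = z.re * (‖w‖ * Real.cos w.arg) + z.im * (‖w‖ * Real.sin w.arg) := by
        rw [Complex.norm_mul_cos_arg, Complex.norm_mul_sin_arg]
    _ = (‖w‖ • directionalPart w.arg) z := by
        rw [smul_apply, directionalPart_apply, smul_eq_mul]
        ring

end DirectionalPart

section ConvexHull

lemma isGreatest_image_convexHull {E : Type*} [AddCommGroup E] [Module ℝ E] (f : E →ₗ[ℝ] ℝ)
    {S : Set E} {m : ℝ} (h : IsGreatest (f '' S) m) : IsGreatest (f '' convexHull ℝ S) m := by
  rw [LinearMap.image_convexHull]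
  exact ⟨subset_convexHull ℝ _ h.1, fun _ hy => convexHull_min h.2 (convex_Iic m) hy⟩

/-- By Carathéodory's theorem, finitely many compact sets of convex combinations suffice. -/
lemma isCompact_convexHull {E : Type*} [NormedAddCommGroup E] [NormedSpace ℝ E]
    [FiniteDimensional ℝ E] {S : Set E} (hS : IsCompact S) : IsCompact (convexHull ℝ S) := by
  let combinations (k : ℕ) : Set E :=
    (fun p : (Fin k → ℝ) × (Fin k → E) => ∑ i, p.1 i • p.2 i) ''
      (stdSimplex ℝ (Fin k) ×ˢ Set.univ.pi fun _ => S)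
  have hcompact (k : ℕ) : IsCompact (combinations k) :=
    ((isCompact_stdSimplex ℝ (Fin k)).prod (isCompact_univ_pi fun _ => hS)).image (by fun_prop)
  suffices convexHull ℝ S = ⋃ k ∈ Finset.range (Module.finrank ℝ E + 2), combinations k by
    rw [this]
    exact Finset.isCompact_biUnion _ fun k _ => hcompact k
  apply Set.Subset.antisymm
  · intro x hx
    obtain ⟨ι, _, z, w, hz, hind, hw, hw1, rfl⟩ := eq_pos_convex_span_of_mem_convexHull hx
    have hcard : Fintype.card ι ≤ Module.finrank ℝ E + 1 :=
      hind.card_le_finrank_succ.trans (by gcongr; exact Submodule.finrank_le _)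
    let e := Fintype.equivFin ι
    refine Set.mem_biUnion (Finset.mem_coe.2 (Finset.mem_range.2 (Nat.lt_succ_of_le hcard)))
      ⟨(w ∘ e.symm, z ∘ e.symm), ⟨⟨fun i => (hw _).le, ?_⟩, fun i _ => hz ⟨_, rfl⟩⟩, ?_⟩
    · exact (Equiv.sum_comp e.symm w).trans hw1
    · exact Equiv.sum_comp e.symm fun i => w i • z i
  · refine Set.iUnion₂_subset ?_
    rintro k - _ ⟨⟨w, z⟩, ⟨⟨hw0, hw1⟩, hz⟩, rfl⟩
    exact (convex_convexHull ℝ S).sum_mem (fun i _ => hw0 i) hw1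
      fun i _ => subset_convexHull ℝ S (hz i trivial)

end ConvexHull

/-- `h` is the support function of the plane set `S`: the maximum of the component in the
direction `exp (iθ)` over `S` is attained and equals `h θ`. -/
def IsSupportFunction (S : Set ℂ) (h : ℝ → ℝ) : Prop :=
  ∀ θ, IsGreatest (directionalPart θ '' S) (h θ)

namespace IsSupportFunction

variable {S T : Set ℂ} {h k : ℝ → ℝ}

protected lemma convexHull (hS : IsSupportFunction S h) : IsSupportFunction (convexHull ℝ S) h :=
  fun θ => isGreatest_image_convexHull (directionalPart θ).toLinearMap (hS θ)

lemma union (hS : IsSupportFunction S h) (hT : IsSupportFunction T k) :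
    IsSupportFunction (S ∪ T) (h ⊔ k) := fun θ => by
  rw [Set.image_union]
  exact (hS θ).union (hT θ)

lemma subset_iff (hS : IsSupportFunction S h) (hT : IsSupportFunction T k)
    (hconv : Convex ℝ T) (hclosed : IsClosed T) : S ⊆ T ↔ ∀ θ, h θ ≤ k θ := by
  refine ⟨fun hST θ => (hT θ).2 (Set.image_mono hST (hS θ).1), fun hle z hz => ?_⟩
  by_contra hzT
  obtain ⟨f, u, hf, hu⟩ := geometric_hahn_banach_closed_point hconv hclosed hzT
  obtain ⟨r, hr, θ, rfl⟩ := exists_eq_smul_directionalPart f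
  obtain ⟨w, hw, hwk⟩ := (hT θ).1
  have hlt : directionalPart θ w < directionalPart θ z :=
    lt_of_mul_lt_mul_left ((hf w hw).trans hu) hr
  exact hlt.not_ge (((hS θ).2 ⟨z, hz, rfl⟩).trans ((hle θ).trans_eq hwk.symm))

lemma eq_of_convex_of_isClosed (hS : IsSupportFunction S h) (hT : IsSupportFunction T h)
    (hSconv : Convex ℝ S) (hSclosed : IsClosed S) (hTconv : Convex ℝ T) (hTclosed : IsClosed T) :
    S = T :=
  ((hS.subset_iff hT hTconv hTclosed).2 fun _ => le_rfl).antisymm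
    ((hT.subset_iff hS hSconv hSclosed).2 fun _ => le_rfl)

lemma not_subset_convexHull_iff (hS : IsSupportFunction S h) (hT : IsSupportFunction T k)
    (hcompact : IsCompact T) : ¬ S ⊆ convexHull ℝ T ↔ ∃ θ, k θ < h θ := by
  rw [hS.subset_iff hT.convexHull (convex_convexHull ℝ T) (isCompact_convexHull hcompact).isClosed]
  push Not
  rfl

end IsSupportFunction

section Ellipse

/-- The ellipse with center `c` and semi-axes `p` and `q`, the first of direction `exp (iφ)`, in
the parametrization used by `IsEllipse`. -/
def ellipse (c : ℂ) (φ p q : ℝ) : Set ℂ :=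
  Set.range fun t : ℝ =>
    c + Complex.exp (φ * Complex.I) * ((p * Real.cos t : ℝ) + (q * Real.sin t : ℝ) * Complex.I)

lemma isCompact_ellipse (c : ℂ) (φ p q : ℝ) : IsCompact (ellipse c φ p q) := by
  refine Function.Periodic.compact_of_continuous (c := 2 * π) (fun t => ?_) Real.two_pi_pos.ne' ?_
  · rw [Real.cos_add_two_pi, Real.sin_add_two_pi]
  · fun_prop

lemma isSupportFunction_ellipse (c : ℂ) (φ p q : ℝ) :
    IsSupportFunction (ellipse c φ p q) fun θ =>
      directionalPart θ c + ‖(⟨p * Real.cos (θ - φ), q * Real.sin (θ - φ)⟩ : ℂ)‖ := fun θ => by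
  set w : ℂ := ⟨p * Real.cos (θ - φ), q * Real.sin (θ - φ)⟩ with hw
  have hparam (t : ℝ) : directionalPart θ (c + Complex.exp (φ * Complex.I) *
      ((p * Real.cos t : ℝ) + (q * Real.sin t : ℝ) * Complex.I))
      = directionalPart θ c + directionalPart t w := by
    simp only [directionalPart_apply, hw, Real.cos_sub, Real.sin_sub, Complex.mul_re,
      Complex.mul_im, Complex.exp_ofReal_mul_I_re, Complex.exp_ofReal_mul_I_im, Complex.add_re,
      Complex.add_im, Complex.ofReal_re, Complex.ofReal_im, Complex.I_re, Complex.I_im]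
    ring
  have himage : directionalPart θ '' ellipse c φ p q
      = (directionalPart θ c + ·) '' Set.range fun t => directionalPart t w := by
    rw [ellipse, ← Set.range_comp, ← Set.range_comp]
    exact congrArg Set.range (funext hparam)
  rw [himage]
  exact Monotone.map_isGreatest (fun _ _ hxy => by gcongr) (isGreatest_range_directionalPart w)

lemma IsEllipse.isCompact {E : Set ℂ} {c : ℂ} (hE : IsEllipse E c) : IsCompact E := by
  obtain ⟨φ, p, q, -, -, rfl⟩ := hE
  exact isCompact_ellipse c φ p q

lemma IsEllipse.exists_isSupportFunction {E : Set ℂ} {c : ℂ} (hE : IsEllipse E c) :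
    ∃ r : ℝ → ℝ, ContDiff ℝ ω r ∧ (∀ θ, 0 < r θ) ∧ Function.Periodic r π ∧
      IsSupportFunction E fun θ => directionalPart θ c + r θ := by
  obtain ⟨φ, p, q, hp, hq, rfl⟩ := hE
  let w (θ : ℝ) : ℂ := ⟨p * Real.cos (θ - φ), q * Real.sin (θ - φ)⟩
  have hw0 (θ : ℝ) : w θ ≠ 0 := fun h => by
    have hcos : Real.cos (θ - φ) = 0 :=
      (mul_eq_zero.1 (congrArg Complex.re h)).resolve_left hp.ne'
    have hsin : Real.sin (θ - φ) = 0 :=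
      (mul_eq_zero.1 (congrArg Complex.im h)).resolve_left hq.ne'
    simpa [hcos, hsin] using Real.sin_sq_add_cos_sq (θ - φ)
  have hwdiff : ContDiff ℝ ω w :=
    Complex.equivRealProdCLM.symm.contDiff.comp (ContDiff.prodMk (by fun_prop) (by fun_prop))
  have hwanti : Function.Antiperiodic w π := fun θ => by
    apply Complex.ext <;>
      simp only [w, add_sub_right_comm θ π φ, Real.cos_add_pi, Real.sin_add_pi, mul_neg,
        Complex.neg_re, Complex.neg_im]
  refine ⟨fun θ => ‖w θ‖, hwdiff.norm ℝ hw0, fun θ => norm_pos_iff.2 (hw0 θ), fun θ => ?_,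
    isSupportFunction_ellipse c φ p q⟩
  simp only [hwanti θ, norm_neg]

end Ellipse

section NumericalRange

variable {E : Type*} [NormedAddCommGroup E] [InnerProductSpace ℂ E]

/-- The numerical range of a linear operator, of which `numericalRange` is the case of matrices. -/
def operatorNumericalRange (T : E →ₗ[ℂ] E) : Set ℂ :=
  {z | ∃ x, ‖x‖ = 1 ∧ inner ℂ x (T x) = z}

lemma inner_div_norm_sq_mem_operatorNumericalRange (T : E →ₗ[ℂ] E) {x : E} (hx : x ≠ 0) :
    inner ℂ x (T x) / (‖x‖ : ℂ) ^ 2 ∈ operatorNumericalRange T := by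
  refine ⟨(‖x‖ : ℂ)⁻¹ • x, norm_smul_inv_norm hx, ?_⟩
  rw [map_smul, inner_smul_left, inner_smul_right, map_inv₀, Complex.conj_ofReal]
  ring

lemma mul_add_mem_operatorNumericalRange {T : E →ₗ[ℂ] E} {z : ℂ}
    (hz : z ∈ operatorNumericalRange T) (α β : ℂ) :
    α * z + β ∈ operatorNumericalRange (α • T + β • LinearMap.id) := by
  obtain ⟨x, hx, rfl⟩ := hz
  refine ⟨x, hx, ?_⟩
  rw [LinearMap.add_apply, LinearMap.smul_apply, LinearMap.smul_apply, LinearMap.id_apply,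
    inner_add_right, inner_smul_right, inner_smul_right, inner_self_eq_norm_sq_to_K, hx]
  simp

lemma exists_norm_eq_one_and_mul_add_conj_mul_im_eq_zero (z w : ℂ) :
    ∃ u : ℂ, ‖u‖ = 1 ∧ (u * z + conj u * w).im = 0 := by
  obtain ⟨u, hu, hreal⟩ := RCLike.exists_norm_eq_mul_self (z - conj w)
  refine ⟨u, hu, ?_⟩
  have him := congrArg Complex.im hreal
  simp only [Complex.coe_algebraMap, Complex.ofReal_im, Complex.mul_im, Complex.sub_re,
    Complex.sub_im, Complex.conj_re, Complex.conj_im] at him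
  simp only [Complex.add_im, Complex.mul_im, Complex.conj_re, Complex.conj_im]
  linear_combination -him

lemma ofReal_mem_operatorNumericalRange_of_im_eq_zero {T : E →ₗ[ℂ] E} {f g : E} (hf : ‖f‖ = 1)
    (hg : ‖g‖ = 1) (hTf : inner ℂ f (T f) = 0) (hTg : inner ℂ g (T g) = 1)
    (him : (inner ℂ f (T g) + inner ℂ g (T f)).im = 0) {s : ℝ} (hs : s ∈ Set.Icc (0 : ℝ) 1) :
    (s : ℂ) ∈ operatorNumericalRange T := by
  have hind : LinearIndependent ℂ ![f, g] := by
    refine (LinearIndependent.pair_iff' (norm_ne_zero_iff.1 (hf ▸ one_ne_zero))).2 ?_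
    rintro a rfl
    rw [map_smul, inner_smul_left, inner_smul_right, hTf] at hTg
    simp at hTg
  let v (t : ℝ) : E := (1 - t : ℂ) • f + (t : ℂ) • g
  have hv (t : ℝ) : v t ≠ 0 := fun h => by
    obtain ⟨h₁, h₂⟩ := LinearIndependent.pair_iff.1 hind _ _ h
    simp [h₂] at h₁
  obtain ⟨r, hr⟩ : ∃ r : ℝ, inner ℂ f (T g) + inner ℂ g (T f) = r :=
    ⟨_, Complex.ext rfl him⟩
  have hTv (t : ℝ) : inner ℂ (v t) (T (v t)) = (t ^ 2 + t * (1 - t) * r : ℝ) := by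
    simp only [v, map_add, map_smul, inner_add_left, inner_add_right, inner_smul_left,
      inner_smul_right, hTf, hTg, Complex.conj_ofReal, map_sub, map_one]
    push_cast
    linear_combination (t : ℂ) * (1 - t) * hr
  let value (t : ℝ) : ℝ := (t ^ 2 + t * (1 - t) * r) / ‖v t‖ ^ 2
  have hcont : Continuous value :=
    Continuous.div (by fun_prop) (by fun_prop) fun t => by simpa using hv t
  have hvalue₀ : value 0 = 0 := by simp [value]
  have hvalue₁ : value 1 = 1 := by simp [value, v, hg]
  obtain ⟨t, -, rfl⟩ := intermediate_value_Icc zero_le_one hcont.continuousOn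
    (by rwa [hvalue₀, hvalue₁])
  simpa [value, hTv] using inner_div_norm_sq_mem_operatorNumericalRange T (hv t)

lemma ofReal_mem_operatorNumericalRange {T : E →ₗ[ℂ] E} (h₀ : 0 ∈ operatorNumericalRange T)
    (h₁ : 1 ∈ operatorNumericalRange T) {s : ℝ} (hs : s ∈ Set.Icc (0 : ℝ) 1) :
    (s : ℂ) ∈ operatorNumericalRange T := by
  obtain ⟨f, hf, hTf⟩ := h₀
  obtain ⟨g, hg, hTg⟩ := h₁
  obtain ⟨u, hu, him⟩ :=
    exists_norm_eq_one_and_mul_add_conj_mul_im_eq_zero (inner ℂ f (T g)) (inner ℂ g (T f))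
  refine ofReal_mem_operatorNumericalRange_of_im_eq_zero (g := u • g) hf ?_ hTf ?_ ?_ hs
  · rw [norm_smul, hu, hg, one_mul]
  · rw [map_smul, inner_smul_left, inner_smul_right, hTg, mul_one, Complex.conj_mul', hu]
    simp
  · rwa [map_smul, inner_smul_left, inner_smul_right]

/-- The **Toeplitz–Hausdorff theorem**. -/
theorem convex_operatorNumericalRange (T : E →ₗ[ℂ] E) : Convex ℝ (operatorNumericalRange T) := by
  rw [convex_iff_segment_subset]
  intro z hz w hw
  rw [segment_eq_image]
  rintro _ ⟨s, hs, rfl⟩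
  rcases eq_or_ne w z with rfl | hne
  · simpa only [← add_smul, sub_add_cancel, one_smul] using hz
  have hd : w - z ≠ 0 := sub_ne_zero.2 hne
  let T' : E →ₗ[ℂ] E := (w - z)⁻¹ • T + (-(w - z)⁻¹ * z) • LinearMap.id
  have hz' : 0 ∈ operatorNumericalRange T' := by
    convert mul_add_mem_operatorNumericalRange hz (w - z)⁻¹ (-(w - z)⁻¹ * z) using 1
    ring
  have hw' : 1 ∈ operatorNumericalRange T' := by
    convert mul_add_mem_operatorNumericalRange hw (w - z)⁻¹ (-(w - z)⁻¹ * z) using 1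
    rw [neg_mul, ← sub_eq_add_neg, ← mul_sub, inv_mul_cancel₀ hd]
  have hT : T = (w - z) • T' + z • LinearMap.id := by
    ext x
    simp [T', smul_smul, hd]
  rw [hT]
  convert mul_add_mem_operatorNumericalRange (ofReal_mem_operatorNumericalRange hz' hw' hs)
    (w - z) z using 1
  simp only [Complex.real_smul]
  push_cast
  ring

lemma isCompact_operatorNumericalRange [FiniteDimensional ℂ E] (T : E →ₗ[ℂ] E) :
    IsCompact (operatorNumericalRange T) := by
  have himage : operatorNumericalRange T = (fun x => inner ℂ x (T x)) '' Metric.sphere 0 1 := by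
    ext z
    simp [operatorNumericalRange]
  have : ProperSpace E := FiniteDimensional.proper ℂ E
  rw [himage]
  exact (isCompact_sphere _ _).image
    (continuous_id.inner (LinearMap.continuous_of_finiteDimensional T))

lemma mem_upperBounds_directionalPart_operatorNumericalRange_iff {T : E →ₗ[ℂ] E} {θ m : ℝ} :
    m ∈ upperBounds (directionalPart θ '' operatorNumericalRange T)
      ↔ ∀ x, directionalPart θ (inner ℂ x (T x)) ≤ m * ‖x‖ ^ 2 := by
  refine ⟨fun hm x => ?_, ?_⟩
  · rcases eq_or_ne x 0 with rfl | hx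
    · simp
    have hle := hm ⟨_, inner_div_norm_sq_mem_operatorNumericalRange T hx, rfl⟩
    rw [← Complex.ofReal_pow, div_eq_inv_mul, ← Complex.ofReal_inv, ← Complex.real_smul, map_smul,
      smul_eq_mul, inv_mul_le_iff₀ (by positivity), mul_comm] at hle
    exact hle
  · rintro hm _ ⟨_, ⟨x, hx, rfl⟩, rfl⟩
    simpa [hx] using hm x

lemma isGreatest_iff_isLUB_of_isClosed {α : Type*} [TopologicalSpace α] [LinearOrder α]
    [OrderTopology α] [NoBotOrder α] {s : Set α} (hs : IsClosed s) {m : α} :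
    IsGreatest s m ↔ IsLUB s m :=
  ⟨IsGreatest.isLUB, fun h => ⟨h.mem_of_isClosed h.nonempty hs, h.1⟩⟩

variable [CompleteSpace E]

lemma mem_upperBounds_spectrum_iff {H : E →L[ℂ] E} (hH : IsSelfAdjoint H) {m : ℝ} :
    m ∈ upperBounds (spectrum ℝ H) ↔ ∀ x, (inner ℂ x (H x)).re ≤ m * ‖x‖ ^ 2 := by
  have hsa : IsSelfAdjoint (algebraMap ℝ (E →L[ℂ] E) m - H) :=
    ((IsSelfAdjoint.all m).algebraMap _).sub hH
  have hform (x : E) : (algebraMap ℝ (E →L[ℂ] E) m - H).reApplyInnerSelf x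
      = m * ‖x‖ ^ 2 - (inner ℂ x (H x)).re := by
    rw [ContinuousLinearMap.reApplyInnerSelf_apply, inner_re_symm,
      Algebra.algebraMap_eq_smul_one, sub_apply, smul_apply, one_apply_eq_self, inner_sub_right,
      inner_smul_right_eq_smul, inner_self_eq_norm_sq_to_K]
    simp [← Complex.ofReal_pow]
  calc m ∈ upperBounds (spectrum ℝ H) ↔ H ≤ algebraMap ℝ (E →L[ℂ] E) m :=
        (le_algebraMap_iff_spectrum_le (ha := hH)).symm
    _ ↔ ∀ x, (inner ℂ x (H x)).re ≤ m * ‖x‖ ^ 2 := by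
        rw [ContinuousLinearMap.le_def, ContinuousLinearMap.isPositive_def', and_iff_right hsa]
        simp only [hform, sub_nonneg]

lemma re_inner_realPart (T : E →L[ℂ] E) (x : E) :
    (inner ℂ x ((ℜ T : E →L[ℂ] E) x)).re = (inner ℂ x (T x)).re := by
  rw [realPart_apply_coe, ContinuousLinearMap.star_eq_adjoint, smul_apply, add_apply,
    inner_smul_right_eq_smul, inner_add_right, ContinuousLinearMap.adjoint_inner_right,
    Complex.smul_re, Complex.add_re, ← inner_conj_symm x (T x), Complex.conj_re, smul_eq_mul]
  ring

/-- Kippenhahn's description of the supporting lines of a numerical range. -/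
lemma isGreatest_directionalPart_operatorNumericalRange_iff [FiniteDimensional ℂ E]
    {T : E →L[ℂ] E} {θ m : ℝ} :
    IsGreatest (directionalPart θ '' operatorNumericalRange T.toLinearMap) m
      ↔ IsGreatest
          (spectrum ℝ (ℜ (Complex.exp ((-θ : ℝ) * Complex.I) • T) : E →L[ℂ] E)) m := by
  have hsa : IsSelfAdjoint (ℜ (Complex.exp ((-θ : ℝ) * Complex.I) • T) : E →L[ℂ] E) :=
    Subtype.property _
  have hbounds : upperBounds (directionalPart θ '' operatorNumericalRange T.toLinearMap)
      = upperBounds (spectrum ℝ (ℜ (Complex.exp ((-θ : ℝ) * Complex.I) • T) : E →L[ℂ] E)) := by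
    ext m
    rw [mem_upperBounds_directionalPart_operatorNumericalRange_iff,
      mem_upperBounds_spectrum_iff hsa]
    simp only [re_inner_realPart, smul_apply, inner_smul_right, directionalPart_eq_re_exp_mul]
    rfl
  have hclosed : IsClosed (directionalPart θ '' operatorNumericalRange T.toLinearMap) :=
    ((isCompact_operatorNumericalRange _).image (directionalPart θ).continuous).isClosed
  rw [isGreatest_iff_isLUB_of_isClosed hclosed,
    isGreatest_iff_isLUB_of_isClosed (spectrum.isClosed _), IsLUB, IsLUB, hbounds]

end NumericalRange

section Matrix

variable {n : ℕ} (A : Matrix (Fin n) (Fin n) ℂ)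

lemma spectrum_realPart_toEuclideanCLM :
    spectrum ℝ (ℜ (Matrix.toEuclideanCLM (𝕜 := ℂ) A) :
      EuclideanSpace ℂ (Fin n) →L[ℂ] EuclideanSpace ℂ (Fin n))
      = spectrum ℝ (ℜ A : Matrix (Fin n) (Fin n) ℂ) := by
  rw [← map_realPart, ← spectrum.preimage_algebraMap ℂ (R := ℝ), AlgEquiv.spectrum_eq,
    spectrum.preimage_algebraMap]

lemma isGreatest_directionalPart_numericalRange_iff {θ m : ℝ} :
    IsGreatest (directionalPart θ '' numericalRange A) m
      ↔ IsGreatest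
          (spectrum ℝ (ℜ (Complex.exp ((-θ : ℝ) * Complex.I) • A) : Matrix (Fin n) (Fin n) ℂ))
          m := by
  rw [← spectrum_realPart_toEuclideanCLM, map_smul,
    ← isGreatest_directionalPart_operatorNumericalRange_iff]
  rfl

end Matrix

section ReciprocalMean

variable {a b : ℂ}

lemma reciprocalMean_eq_iff (ha : a ≠ 0) (hb : b ≠ 0) :
    reciprocalMean a = reciprocalMean b ↔ ‖a‖ = ‖b‖ ∨ ‖a‖ = ‖b‖⁻¹ := by
  have ha' : 0 < ‖a‖ := norm_pos_iff.2 ha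
  have hb' : 0 < ‖b‖ := norm_pos_iff.2 hb
  have hfactor : reciprocalMean a - reciprocalMean b
      = (‖a‖ ^ 2 - ‖b‖ ^ 2) * ((‖a‖ * ‖b‖) ^ 2 - 1) / (2 * ‖a‖ ^ 2 * ‖b‖ ^ 2) := by
    rw [reciprocalMean, reciprocalMean]
    field_simp
    ring
  have hden : 2 * ‖a‖ ^ 2 * ‖b‖ ^ 2 ≠ 0 := by positivity
  rw [← sub_eq_zero, hfactor, div_eq_zero_iff, or_iff_left hden, mul_eq_zero, sub_eq_zero,
    sub_eq_zero, pow_left_inj₀ ha'.le hb'.le two_ne_zero,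
    pow_eq_one_iff_of_nonneg (by positivity) two_ne_zero, mul_eq_one_iff_eq_inv₀ hb'.ne']

lemma reciprocalMean_one : reciprocalMean 1 = 1 := by
  simp [reciprocalMean]

lemma reciprocalMean_eq_one_iff (ha : a ≠ 0) : reciprocalMean a = 1 ↔ ‖a‖ = 1 := by
  simpa [reciprocalMean_one] using reciprocalMean_eq_iff ha one_ne_zero

lemma one_le_reciprocalMean (ha : a ≠ 0) : 1 ≤ reciprocalMean a := by
  have hsub : reciprocalMean a - 1 = (‖a‖ ^ 2 - 1) ^ 2 / (2 * ‖a‖ ^ 2) := by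
    rw [reciprocalMean]
    field_simp
    ring
  rw [← sub_nonneg, hsub]
  positivity

lemma one_lt_reciprocalMean_iff (ha : a ≠ 0) : 1 < reciprocalMean a ↔ ‖a‖ ≠ 1 := by
  rw [(one_le_reciprocalMean ha).lt_iff_ne, ne_comm, Ne, reciprocalMean_eq_one_iff ha]

lemma reciprocalMean_eq_and_one_lt_iff (ha : a ≠ 0) (hb : b ≠ 0) :
    (reciprocalMean a = reciprocalMean b ∧ 1 < reciprocalMean b) ↔
      (‖a‖ = ‖b‖ ∧ ‖b‖ ≠ 1) ∨ (‖a‖ = ‖b‖⁻¹ ∧ ‖b‖⁻¹ ≠ 1) := by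
  rw [reciprocalMean_eq_iff ha hb, one_lt_reciprocalMean_iff hb, or_and_right, Ne, Ne, inv_eq_one]

end ReciprocalMean

section ReciprocalMatrix

/-- The characteristic polynomial, evaluated at `μ`, of a tridiagonal `4 × 4` matrix with zero
diagonal; `s₁, s₂, s₃` are the products of its opposite off-diagonal entries. -/
def tridiagonalQuartic {R : Type*} [CommRing R] (s₁ s₂ s₃ μ : R) : R :=
  μ ^ 4 - (s₁ + s₂ + s₃) * μ ^ 2 + s₁ * s₃

lemma eval_charpoly_tridiagonal {R : Type*} [CommRing R] (b₁ b₂ b₃ c₁ c₂ c₃ μ : R) :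
    !![0, b₁, 0, 0; c₁, 0, b₂, 0; 0, c₂, 0, b₃; 0, 0, c₃, 0].charpoly.eval μ
      = tridiagonalQuartic (b₁ * c₁) (b₂ * c₂) (b₃ * c₃) μ := by
  simp [Matrix.eval_charpoly, Matrix.det_succ_row_zero, Fin.sum_univ_succ, Fin.succAbove,
    tridiagonalQuartic]
  ring

/-- The entry next to the diagonal of `Re (exp (-iθ) A)`, where `A` has the entry `a` there and
`a⁻¹` in the opposite position. -/
noncomputable def rotatedEntry (θ : ℝ) (a : ℂ) : ℂ :=
  (Complex.exp ((-θ : ℝ) * Complex.I) * a + conj (Complex.exp ((-θ : ℝ) * Complex.I) * a⁻¹)) / 2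

/-- The squared modulus `(A + cos 2θ) / 2` of `rotatedEntry θ a`, in terms of
`A = reciprocalMean a`. -/
noncomputable def rotatedNormSq (A θ : ℝ) : ℝ := (A + Real.cos (2 * θ)) / 2

lemma rotatedEntry_mul_rotatedEntry_inv (θ : ℝ) {a : ℂ} (ha : a ≠ 0) :
    rotatedEntry θ a * rotatedEntry θ a⁻¹ = rotatedNormSq (reciprocalMean a) θ := by
  set e := Complex.exp ((-θ : ℝ) * Complex.I) with he
  have hconj : conj e = Complex.exp (θ * Complex.I) := by
    rw [he, ← Complex.exp_conj]
    simp
  have hunit : e * conj e = 1 := by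
    rw [hconj, he, ← Complex.exp_add]
    simp
  have hcos : e ^ 2 + conj e ^ 2 = 2 * Complex.cos (2 * θ) := by
    rw [hconj, he, ← Complex.exp_nat_mul, ← Complex.exp_nat_mul, Complex.two_cos, add_comm]
    push_cast
    ring_nf
  have hconj_a : conj a ≠ 0 := (map_ne_zero _).2 ha
  have hmean : (2 * reciprocalMean a : ℂ) = a * conj a + (a * conj a)⁻¹ := by
    rw [Complex.mul_conj', reciprocalMean]
    push_cast
    ring
  calc rotatedEntry θ a * rotatedEntry θ a⁻¹
      = (e ^ 2 + conj e ^ 2 + e * conj e * (a * conj a + (a * conj a)⁻¹)) / 4 := by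
        simp only [rotatedEntry, ← he, inv_inv, map_mul, map_inv₀]
        field_simp
        ring
    _ = rotatedNormSq (reciprocalMean a) θ := by
        rw [hcos, hunit, ← hmean, rotatedNormSq]
        push_cast
        ring

lemma realPart_exp_smul_reciprocalMatrix (θ : ℝ) (a₁ a₂ a₃ : ℂ) :
    (ℜ (Complex.exp ((-θ : ℝ) * Complex.I) • reciprocalMatrix a₁ a₂ a₃) :
      Matrix (Fin 4) (Fin 4) ℂ)
      = !![0, rotatedEntry θ a₁, 0, 0;
           rotatedEntry θ a₁⁻¹, 0, rotatedEntry θ a₂, 0;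
           0, rotatedEntry θ a₂⁻¹, 0, rotatedEntry θ a₃;
           0, 0, rotatedEntry θ a₃⁻¹, 0] := by
  rw [realPart_apply_coe]
  ext i j
  fin_cases i <;> fin_cases j <;>
    simp [reciprocalMatrix, rotatedEntry, Matrix.star_apply, div_eq_inv_mul, mul_add]

/-- The Kippenhahn polynomial `det (μ - Re (exp (-iθ) A))` of the reciprocal matrix `A` whose
entries have reciprocal means `A₁, A₂, A₃`. -/
noncomputable def kippenhahnQuartic (A₁ A₂ A₃ θ μ : ℝ) : ℝ :=
  tridiagonalQuartic (rotatedNormSq A₁ θ) (rotatedNormSq A₂ θ) (rotatedNormSq A₃ θ) μ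

variable {a₁ a₂ a₃ : ℂ}

lemma spectrum_realPart_exp_smul_reciprocalMatrix (h₁ : a₁ ≠ 0) (h₂ : a₂ ≠ 0) (h₃ : a₃ ≠ 0)
    (θ : ℝ) :
    spectrum ℝ (ℜ (Complex.exp ((-θ : ℝ) * Complex.I) • reciprocalMatrix a₁ a₂ a₃) :
        Matrix (Fin 4) (Fin 4) ℂ)
      = {μ | kippenhahnQuartic (reciprocalMean a₁) (reciprocalMean a₂) (reciprocalMean a₃) θ μ
          = 0} := by
  ext μ
  rw [← spectrum.preimage_algebraMap ℂ, Set.mem_preimage,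
    Matrix.mem_spectrum_iff_isRoot_charpoly, realPart_exp_smul_reciprocalMatrix, Polynomial.IsRoot,
    eval_charpoly_tridiagonal, rotatedEntry_mul_rotatedEntry_inv θ h₁,
    rotatedEntry_mul_rotatedEntry_inv θ h₂, rotatedEntry_mul_rotatedEntry_inv θ h₃]
  simp only [kippenhahnQuartic, tridiagonalQuartic, Complex.coe_algebraMap]
  norm_cast

lemma isSupportFunction_numericalRange_reciprocalMatrix_iff (h₁ : a₁ ≠ 0) (h₂ : a₂ ≠ 0)
    (h₃ : a₃ ≠ 0) {h : ℝ → ℝ} :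
    IsSupportFunction (numericalRange (reciprocalMatrix a₁ a₂ a₃)) h ↔
      ∀ θ, IsGreatest {μ | kippenhahnQuartic (reciprocalMean a₁) (reciprocalMean a₂)
        (reciprocalMean a₃) θ μ = 0} (h θ) :=
  forall_congr' fun θ => by
    rw [isGreatest_directionalPart_numericalRange_iff,
      spectrum_realPart_exp_smul_reciprocalMatrix h₁ h₂ h₃]

end ReciprocalMatrix

section BiElliptical

lemma isGreatest_root_tridiagonalQuartic {s₁ s₂ s₃ m : ℝ} (hm : 0 ≤ m)
    (hroot : tridiagonalQuartic s₁ s₂ s₃ m = 0) (hlarge : s₁ + s₂ + s₃ ≤ 2 * m ^ 2) :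
    IsGreatest {μ | tridiagonalQuartic s₁ s₂ s₃ μ = 0} m := by
  refine ⟨hroot, fun μ (hμ : tridiagonalQuartic s₁ s₂ s₃ μ = 0) => ?_⟩
  rw [tridiagonalQuartic] at hroot hμ
  have hfactor : (μ ^ 2 - m ^ 2) * (μ ^ 2 + m ^ 2 - (s₁ + s₂ + s₃)) = 0 := by
    linear_combination hμ - hroot
  have hsq : μ ^ 2 ≤ m ^ 2 := by
    rcases mul_eq_zero.1 hfactor with h | h <;> linarith
  exact (le_abs_self μ).trans (abs_le_of_sq_le_sq hsq hm)

lemma rotatedNormSq_one (θ : ℝ) : rotatedNormSq 1 θ = Real.cos θ ^ 2 := by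
  rw [rotatedNormSq, Real.cos_two_mul]
  ring

lemma rotatedNormSq_nonneg {A : ℝ} (hA : 1 ≤ A) (θ : ℝ) : 0 ≤ rotatedNormSq A θ := by
  have := Real.neg_one_le_cos (2 * θ)
  rw [rotatedNormSq]
  linarith

/-- The quartic is the product of `μ² - k μ - s` and `μ² + k μ - s`. -/
lemma isGreatest_root_tridiagonalQuartic_sq {k s : ℝ} (hk : 0 ≤ k) (hs : 0 ≤ s) :
    IsGreatest {μ | tridiagonalQuartic s (k ^ 2) s μ = 0} (k / 2 + √(s + k ^ 2 / 4)) := by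
  obtain ⟨R, hR, hR0⟩ : ∃ R, √(s + k ^ 2 / 4) = R ∧ 0 ≤ R := ⟨_, rfl, Real.sqrt_nonneg _⟩
  have hs_eq : s = R ^ 2 - k ^ 2 / 4 := by
    rw [← hR, Real.sq_sqrt (by positivity), add_sub_cancel_right]
  rw [hR, hs_eq]
  refine isGreatest_root_tridiagonalQuartic (by positivity) ?_ ?_
  · rw [tridiagonalQuartic]
    ring
  · linear_combination 2 * mul_nonneg hk hR0

lemma isGreatest_root_kippenhahnQuartic {B : ℝ} (hB : 1 ≤ B) (θ : ℝ) :
    IsGreatest {μ | kippenhahnQuartic B 1 B θ μ = 0}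
      (|Real.cos θ| / 2 + √(rotatedNormSq B θ + Real.cos θ ^ 2 / 4)) := by
  simp only [kippenhahnQuartic, rotatedNormSq_one, ← sq_abs (Real.cos θ)]
  exact isGreatest_root_tridiagonalQuartic_sq (abs_nonneg _) (rotatedNormSq_nonneg hB θ)

lemma exists_isEllipse_isSupportFunction_add_sqrt {B : ℝ} (hB : 1 < B) (c : ℂ) :
    ∃ E, IsEllipse E c ∧ IsSupportFunction E fun θ =>
      directionalPart θ c + √(rotatedNormSq B θ + Real.cos θ ^ 2 / 4) := by
  have hp : 0 < (2 * B + 3) / 4 := by linarith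
  have hq : 0 < (B - 1) / 2 := by linarith
  refine ⟨ellipse c 0 √((2 * B + 3) / 4) √((B - 1) / 2),
    ⟨0, _, _, Real.sqrt_pos.2 hp, Real.sqrt_pos.2 hq, rfl⟩, ?_⟩
  convert isSupportFunction_ellipse c 0 √((2 * B + 3) / 4) √((B - 1) / 2) using 4 with θ
  rw [Complex.norm_def, Complex.normSq_mk, sub_zero, rotatedNormSq, Real.cos_two_mul]
  congr 1
  linear_combination -Real.cos θ ^ 2 * Real.sq_sqrt hp.le - Real.sin θ ^ 2 * Real.sq_sqrt hq.le
    - (B - 1) / 2 * Real.sin_sq_add_cos_sq θ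

lemma isBiElliptical_numericalRange_reciprocalMatrix {a₁ a₂ a₃ : ℂ} (h₁ : a₁ ≠ 0) (h₂ : a₂ ≠ 0)
    (h₃ : a₃ ≠ 0) (h₁₃ : reciprocalMean a₁ = reciprocalMean a₃) (hlt : 1 < reciprocalMean a₃)
    (h₂' : reciprocalMean a₂ = 1) :
    IsBiElliptical (numericalRange (reciprocalMatrix a₁ a₂ a₃)) := by
  obtain ⟨E₁, hE₁, hsupp₁⟩ := exists_isEllipse_isSupportFunction_add_sqrt hlt (1 / 2)
  obtain ⟨E₂, hE₂, hsupp₂⟩ := exists_isEllipse_isSupportFunction_add_sqrt hlt (-(1 / 2))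
  have hcenter (θ : ℝ) : directionalPart θ (1 / 2) = Real.cos θ / 2 := by
    simp [directionalPart_apply, div_eq_mul_inv]
  refine ⟨E₁, E₂, _, _, hE₁, hE₂, by norm_num, ?_, ?_, ?_⟩
  · rw [hsupp₁.not_subset_convexHull_iff hsupp₂ hE₂.isCompact]
    refine ⟨0, ?_⟩
    gcongr
    rw [map_neg, hcenter, Real.cos_zero]
    norm_num
  · rw [hsupp₂.not_subset_convexHull_iff hsupp₁ hE₁.isCompact]
    refine ⟨π, ?_⟩
    gcongr
    rw [map_neg, hcenter, Real.cos_pi]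
    norm_num
  · have hW : IsSupportFunction (numericalRange (reciprocalMatrix a₁ a₂ a₃)) fun θ =>
        |Real.cos θ| / 2 + √(rotatedNormSq (reciprocalMean a₃) θ + Real.cos θ ^ 2 / 4) := by
      rw [isSupportFunction_numericalRange_reciprocalMatrix_iff h₁ h₂ h₃, h₁₃, h₂']
      exact isGreatest_root_kippenhahnQuartic hlt.le
    refine hW.eq_of_convex_of_isClosed ?_ (convex_operatorNumericalRange _)
      (isCompact_operatorNumericalRange _).isClosed (convex_convexHull ℝ _)
      (isCompact_convexHull (hE₁.isCompact.union hE₂.isCompact)).isClosed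
    convert (hsupp₁.union hsupp₂).convexHull using 1
    ext θ
    rw [Pi.sup_apply, map_neg, hcenter, max_add_add_right, ← abs_eq_max_neg, abs_div, abs_two]

end BiElliptical

section EllipseInNumericalRange

lemma eq_of_contDiff_omega_of_eventuallyEq {E F : Type*} [NormedAddCommGroup E] [NormedSpace ℝ E]
    [NormedAddCommGroup F] [NormedSpace ℝ F] [CompleteSpace F] {f g : E → F} (hf : ContDiff ℝ ω f)
    (hg : ContDiff ℝ ω g) {x : E} (h : f =ᶠ[nhds x] g) : f = g :=
  (contDiff_omega_iff_analyticOnNhd.1 hf).eq_of_eventuallyEq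
    (contDiff_omega_iff_analyticOnNhd.1 hg) h

lemma contDiff_kippenhahnQuartic {f : ℝ → ℝ} (A₁ A₂ A₃ : ℝ) (hf : ContDiff ℝ ω f) :
    ContDiff ℝ ω fun θ => kippenhahnQuartic A₁ A₂ A₃ θ (f θ) := by
  simp only [kippenhahnQuartic, tridiagonalQuartic, rotatedNormSq]
  fun_prop

lemma kippenhahnQuartic_add_pi (A₁ A₂ A₃ θ μ : ℝ) :
    kippenhahnQuartic A₁ A₂ A₃ (θ + π) μ = kippenhahnQuartic A₁ A₂ A₃ θ μ := by
  simp only [kippenhahnQuartic, rotatedNormSq, mul_add, Real.cos_add_two_pi]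

lemma sum_eq_and_mul_eq_of_tridiagonalQuartic_eq_zero {s₁ s₂ s₃ l r : ℝ} (hl : l ≠ 0) (hr : r ≠ 0)
    (hplus : tridiagonalQuartic s₁ s₂ s₃ (l + r) = 0)
    (hminus : tridiagonalQuartic s₁ s₂ s₃ (-l + r) = 0) :
    s₁ + s₂ + s₃ = 2 * (l ^ 2 + r ^ 2) ∧ s₁ * s₃ = (l ^ 2 - r ^ 2) ^ 2 := by
  rw [tridiagonalQuartic] at hplus hminus
  have hsum : s₁ + s₂ + s₃ = 2 * (l ^ 2 + r ^ 2) := by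
    refine mul_left_cancel₀ (mul_ne_zero hl hr) ?_
    linear_combination (hminus - hplus) / 4
  refine ⟨hsum, ?_⟩
  rw [hsum] at hplus
  linear_combination hplus

lemma sum_eq_and_mul_eq_of_eventually_root {A₁ A₂ A₃ : ℝ} {c : ℂ} (hc : c ≠ 0) {r : ℝ → ℝ}
    (hr : ContDiff ℝ ω r) (hpos : ∀ θ, 0 < r θ) (hper : Function.Periodic r π) {t : ℝ}
    (hroot : ∀ᶠ θ in nhds t, kippenhahnQuartic A₁ A₂ A₃ θ (directionalPart θ c + r θ) = 0) (θ : ℝ) :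
    rotatedNormSq A₁ θ + rotatedNormSq A₂ θ + rotatedNormSq A₃ θ
        = 2 * (directionalPart θ c ^ 2 + r θ ^ 2) ∧
      rotatedNormSq A₁ θ * rotatedNormSq A₃ θ = (directionalPart θ c ^ 2 - r θ ^ 2) ^ 2 := by
  have hl : ContDiff ℝ ω fun θ => directionalPart θ c := contDiff_directionalPart c
  have hplus (θ : ℝ) : kippenhahnQuartic A₁ A₂ A₃ θ (directionalPart θ c + r θ) = 0 :=
    congrFun (eq_of_contDiff_omega_of_eventuallyEq (contDiff_kippenhahnQuartic A₁ A₂ A₃ (hl.add hr))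
      contDiff_const hroot) θ
  have hminus (θ : ℝ) : kippenhahnQuartic A₁ A₂ A₃ θ (-directionalPart θ c + r θ) = 0 := by
    have hanti : directionalPart (θ + π) c = -directionalPart θ c :=
      directionalPart_antiperiodic c θ
    rw [← hplus (θ + π), kippenhahnQuartic_add_pi, hper, hanti]
  have hne : ∀ᶠ θ in nhds c.arg, directionalPart θ c ≠ 0 := by
    refine hl.continuous.continuousAt.eventually_ne ?_
    rw [directionalPart_eq_norm_mul_cos, sub_self, Real.cos_zero, mul_one]
    exact norm_ne_zero_iff.2 hc
  have hvieta := hne.mono fun θ hθ =>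
    sum_eq_and_mul_eq_of_tridiagonalQuartic_eq_zero hθ (hpos θ).ne' (hplus θ) (hminus θ)
  have hs (A : ℝ) : ContDiff ℝ ω (rotatedNormSq A) := by
    unfold rotatedNormSq
    fun_prop
  exact ⟨congrFun (eq_of_contDiff_omega_of_eventuallyEq (((hs A₁).add (hs A₂)).add (hs A₃))
      (by fun_prop) (hvieta.mono fun _ h => h.1)) θ,
    congrFun (eq_of_contDiff_omega_of_eventuallyEq ((hs A₁).mul (hs A₃))
      (by fun_prop) (hvieta.mono fun _ h => h.2)) θ⟩

lemma eq_of_trigonometric_square {A₁ A₃ U V W : ℝ}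
    (h : ∀ φ, (U + V * Real.cos φ + W * Real.sin φ) ^ 2
      = 4 * (A₁ + Real.cos φ) * (A₃ + Real.cos φ)) : A₁ = A₃ := by
  have h₀ := h 0
  have hπ := h π
  have hplus := h (π / 2)
  have hminus := h (-(π / 2))
  simp only [Real.cos_zero, Real.sin_zero, Real.cos_pi, Real.sin_pi, Real.cos_neg, Real.sin_neg,
    Real.cos_pi_div_two, Real.sin_pi_div_two] at h₀ hπ hplus hminus
  have hUW : U * W = 0 := by linear_combination (hplus - hminus) / 4
  have hUV : U * V = 2 * (A₁ + A₃) := by linear_combination (h₀ - hπ) / 4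
  have hU : U ^ 2 + W ^ 2 = 4 * A₁ * A₃ := by linear_combination (hplus + hminus) / 2
  have hV : V ^ 2 = 4 + W ^ 2 := by linear_combination (h₀ + hπ) / 2 - hU
  -- Compare `U² V² = 4 (A₁ + A₃)²` with `U² V² = 4 U² + (U W)² = 4 U²`.
  have hsq : (A₁ - A₃) ^ 2 + W ^ 2 = 0 := by
    linear_combination
      (-(U * V + 2 * (A₁ + A₃)) * hUV + U ^ 2 * hV + U * W * hUW + 4 * hU) / 4
  exact sub_eq_zero.1 (pow_eq_zero_iff two_ne_zero |>.1
    ((add_eq_zero_iff_of_nonneg (sq_nonneg _) (sq_nonneg _)).1 hsq).1)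

lemma directionalPart_sq (θ : ℝ) (z : ℂ) :
    directionalPart θ z ^ 2 = (z.re ^ 2 + z.im ^ 2) / 2
      + (z.re ^ 2 - z.im ^ 2) / 2 * Real.cos (2 * θ) + z.re * z.im * Real.sin (2 * θ) := by
  rw [directionalPart_apply, Real.cos_two_mul, Real.sin_two_mul]
  linear_combination z.im ^ 2 * Real.sin_sq_add_cos_sq θ

lemma eq_of_sum_eq_of_mul_eq {A₁ A₂ A₃ : ℝ} {c : ℂ} {r : ℝ → ℝ}
    (hsum : ∀ θ, rotatedNormSq A₁ θ + rotatedNormSq A₂ θ + rotatedNormSq A₃ θ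
      = 2 * (directionalPart θ c ^ 2 + r θ ^ 2))
    (hmul : ∀ θ, rotatedNormSq A₁ θ * rotatedNormSq A₃ θ
      = (directionalPart θ c ^ 2 - r θ ^ 2) ^ 2) : A₁ = A₃ := by
  refine eq_of_trigonometric_square (U := 4 * (c.re ^ 2 + c.im ^ 2) - (A₁ + A₂ + A₃))
    (V := 4 * (c.re ^ 2 - c.im ^ 2) - 3) (W := 8 * (c.re * c.im)) fun φ => ?_
  have hsumφ := hsum (φ / 2)
  have hmulφ := hmul (φ / 2)
  rw [directionalPart_sq] at hsumφ hmulφ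
  simp only [rotatedNormSq, mul_div_cancel₀ φ two_ne_zero] at hsumφ hmulφ
  have hrφ : r (φ / 2) ^ 2 = (A₁ + A₂ + A₃ + 3 * Real.cos φ) / 4
      - ((c.re ^ 2 + c.im ^ 2) / 2 + (c.re ^ 2 - c.im ^ 2) / 2 * Real.cos φ
        + c.re * c.im * Real.sin φ) := by
    linear_combination -hsumφ / 2
  rw [hrφ] at hmulφ
  linear_combination -16 * hmulφ

lemma eq_and_one_lt_and_eq_one_of_sum_eq_of_mul_eq {A₁ A₂ A₃ : ℝ} (hA₁ : 1 ≤ A₁)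
    (hA₂ : 1 ≤ A₂) {c : ℂ} {r : ℝ → ℝ} (hpos : ∀ θ, 0 < r θ)
    (hsum : ∀ θ, rotatedNormSq A₁ θ + rotatedNormSq A₂ θ + rotatedNormSq A₃ θ
      = 2 * (directionalPart θ c ^ 2 + r θ ^ 2))
    (hmul : ∀ θ, rotatedNormSq A₁ θ * rotatedNormSq A₃ θ
      = (directionalPart θ c ^ 2 - r θ ^ 2) ^ 2) :
    (A₁ = A₃ ∧ 1 < A₃) ∧ A₂ = 1 := by
  obtain rfl := eq_of_sum_eq_of_mul_eq hsum hmul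
  obtain ⟨θ, hθ⟩ : ∃ θ, directionalPart θ c = 0 :=
    ⟨c.arg - π / 2, by simp [directionalPart_eq_norm_mul_cos]⟩
  have hsumθ := hsum θ
  have hmulθ := hmul θ
  rw [hθ] at hsumθ hmulθ
  have hs₁ : rotatedNormSq A₁ θ = r θ ^ 2 := by
    rw [← pow_left_inj₀ (rotatedNormSq_nonneg hA₁ θ) (sq_nonneg _) two_ne_zero]
    linear_combination hmulθ
  have hs₂ : rotatedNormSq A₂ θ = 0 := by linear_combination hsumθ - 2 * hs₁
  rw [rotatedNormSq] at hs₁ hs₂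
  have hA₂' : A₂ = 1 := by linarith [Real.neg_one_le_cos (2 * θ)]
  have hA₁' : 1 < A₁ := by linarith [pow_pos (hpos θ) 2]
  exact ⟨⟨rfl, hA₁'⟩, hA₂'⟩

lemma reciprocalMean_eq_of_numericalRange_eq_convexHull {a₁ a₂ a₃ : ℂ} (h₁ : a₁ ≠ 0)
    (h₂ : a₂ ≠ 0) (h₃ : a₃ ≠ 0) {E₁ E₂ : Set ℂ} {c₁ c₂ : ℂ} (hE₁ : IsEllipse E₁ c₁)
    (hE₂ : IsEllipse E₂ c₂) (hc₁ : c₁ ≠ 0) (hsub : ¬ E₁ ⊆ convexHull ℝ E₂)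
    (hW : numericalRange (reciprocalMatrix a₁ a₂ a₃) = convexHull ℝ (E₁ ∪ E₂)) :
    (reciprocalMean a₁ = reciprocalMean a₃ ∧ 1 < reciprocalMean a₃) ∧ reciprocalMean a₂ = 1 := by
  obtain ⟨r₁, hr₁, hpos, hper, hsupp₁⟩ := hE₁.exists_isSupportFunction
  obtain ⟨r₂, hr₂, -, -, hsupp₂⟩ := hE₂.exists_isSupportFunction
  obtain ⟨t, ht⟩ := (hsupp₁.not_subset_convexHull_iff hsupp₂ hE₂.isCompact).1 hsub
  have hcont {c : ℂ} {r : ℝ → ℝ} (hr : ContDiff ℝ ω r) :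
      ContinuousAt (fun θ => directionalPart θ c + r θ) t :=
    ((contDiff_directionalPart c).add hr).continuous.continuousAt
  have hmax := (isSupportFunction_numericalRange_reciprocalMatrix_iff h₁ h₂ h₃).1
    (hW ▸ (hsupp₁.union hsupp₂).convexHull)
  have hroot : ∀ᶠ θ in nhds t, kippenhahnQuartic (reciprocalMean a₁) (reciprocalMean a₂)
      (reciprocalMean a₃) θ (directionalPart θ c₁ + r₁ θ) = 0 :=
    ((hcont hr₂).eventually_lt (hcont hr₁) ht).mono fun θ hθ => by simpa [hθ.le] using (hmax θ).1
  have hparam := sum_eq_and_mul_eq_of_eventually_root hc₁ hr₁ hpos hper hroot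
  exact eq_and_one_lt_and_eq_one_of_sum_eq_of_mul_eq (one_le_reciprocalMean h₁)
    (one_le_reciprocalMean h₂) hpos (fun θ => (hparam θ).1) fun θ => (hparam θ).2

end EllipseInNumericalRange

theorem theorem6p1 (a₁ a₂ a₃ : ℂ) (h₁ : a₁ ≠ 0) (h₂ : a₂ ≠ 0) (h₃ : a₃ ≠ 0) :
    (IsBiElliptical (numericalRange (reciprocalMatrix a₁ a₂ a₃)) ↔
      (reciprocalMean a₁ = reciprocalMean a₃ ∧ 1 < reciprocalMean a₃) ∧ reciprocalMean a₂ = 1) ∧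
    ((reciprocalMean a₁ = reciprocalMean a₃ ∧ 1 < reciprocalMean a₃) ↔
      (‖a₁‖ = ‖a₃‖ ∧ ‖a₃‖ ≠ 1) ∨ (‖a₁‖ = ‖a₃‖⁻¹ ∧ ‖a₃‖⁻¹ ≠ 1)) ∧
    (reciprocalMean a₂ = 1 ↔ ‖a₂‖ = 1) := by
  refine ⟨⟨?_, fun ⟨⟨h₁₃, hlt⟩, hmean₂⟩ =>
      isBiElliptical_numericalRange_reciprocalMatrix h₁ h₂ h₃ h₁₃ hlt hmean₂⟩,
    reciprocalMean_eq_and_one_lt_iff h₁ h₃, reciprocalMean_eq_one_iff h₂⟩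
  rintro ⟨E₁, E₂, c₁, c₂, hE₁, hE₂, hc, hsub₁, hsub₂, hW⟩
  by_cases hc₁ : c₁ = 0
  · exact reciprocalMean_eq_of_numericalRange_eq_convexHull h₁ h₂ h₃ hE₂ hE₁ (hc₁ ▸ hc.symm) hsub₂
      (by rw [hW, Set.union_comm])
  · exact reciprocalMean_eq_of_numericalRange_eq_convexHull h₁ h₂ h₃ hE₁ hE₂ hc₁ hsub₁ hW
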